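/- Let $F$ be a continuous distribution function on $\mathbb R$ and let $(\alpha_n)_{n\ge1}$ be a sequence of positive reals with $s_n:=\sum_{k=1}^n\alpha_k\to\infty$ as $n\to\infty$. Let $(\mathcal X_n)_{n\ge1}$ be an $F^\alpha$-scheme, i.e. a sequence of independent real random variables on a common probability space such that $\mathcal X_n$ has distribution function $F^{\alpha_n}$ for every $n\ge1$, and let $\mathcal M_n:=\max_{1\le k\le n}\mathcal X_k$ be its partial maxima. Let $(\ell_n)_{n\ge1}$ be a non-decreasing sequence of real numbers, and put $q_n:=1-F(\ell_n)$. Write $\{\mathcal M_n>\ell_n\ \text{ev.}\}$ for the event that $\mathcal M_n>\ell_n$ for all sufficiently large $n$. Then: (i) $\mathbb P(\mathcal M_n>\ell_n\ \text{ev.})$ is either $0$ or $1$. (ii) If $q_n\to c$ as $n\to\infty$ for some $c>0$, then $\mathbb P(\mathcal M_n>\ell_n\ \text{ev.})=1$. (iii) If $q_n\to0$ and $\liminf_{n\to\infty}s_nq_n<\infty$, then $\mathbb P(\mathcal M_n>\ell_n\ \text{ev.})=0$. (iv) If $q_n\to0$ and $s_nq_n\to\infty$, then $$\mathbb P(\mathcal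 M_n>\ell_n\ \text{ev.})=\begin{cases}0&\text{if }K(\ell)=\infty,\\ 1&\text{if }K(\ell)<\infty,\end{cases}\qquad\text{where } K(\ell):=\sum_{n\ge1}e^{-s_nq_n}\bigl(1-e^{-\alpha_{n+1}q_n}\bigr).$$ -/

import Mathlib

open MeasureTheory ProbabilityTheory Filter Topology
open scoped ENNReal

noncomputable section

/-- `X` is an `F^α`-scheme on `(Ω, μ)`: the `X n` are independent random variables and `X n` has
distribution function `F ^ (α n)`. Sequences are indexed from `0`. -/
structure IsFAlphaScheme {Ω : Type*} [MeasurableSpace Ω] (μ : Measure Ω)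
    (F : ℝ → ℝ) (α : ℕ → ℝ) (X : ℕ → Ω → ℝ) : Prop where
  measurable : ∀ n, Measurable (X n)
  indep : iIndepFun X μ
  cdf_eq : ∀ n x, μ {ω | X n ω ≤ x} = ENNReal.ofReal (F x ^ α n)

/-- The partial maximum of `X 0, …, X n`. -/
def partialMax {Ω : Type*} (X : ℕ → Ω → ℝ) (n : ℕ) (ω : Ω) : ℝ :=
  (Finset.range (n + 1)).sup' Finset.nonempty_range_add_one (fun k => X k ω)

/-- The partial sum `s n = α 0 + ⋯ + α n`. -/
def partialSum (α : ℕ → ℝ) (n : ℕ) : ℝ := ∑ k ∈ Finset.range (n + 1), α k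

/-- The tail `q n = 1 - F (ℓ n)`. -/
def tailAt (F : ℝ → ℝ) (ℓ : ℕ → ℝ) (n : ℕ) : ℝ := 1 - F (ℓ n)

/-- The series `K(ℓ)` of nonnegative terms, with value in `[0, ∞]`. -/
def seriesK (F : ℝ → ℝ) (α ℓ : ℕ → ℝ) : ℝ≥0∞ :=
  ∑' n : ℕ, ENNReal.ofReal
    (Real.exp (-(partialSum α n * tailAt F ℓ n)) *
      (1 - Real.exp (-(α (n + 1) * tailAt F ℓ n))))

/-- The event that the partial maxima eventually exceed `ℓ`. -/
def eventuallyAbove {Ω : Type*} (X : ℕ → Ω → ℝ) (ℓ : ℕ → ℝ) : Set Ω :=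
  {ω | ∀ᶠ n in atTop, ℓ n < partialMax X n ω}

end

/-! Let E_n be the event M_n ≤ ℓ_n; the claim concerns whether E_n recurs. With r_n = -log F(ℓ_n),
independence gives P(E_n) = exp(-s_n r_n), and P(E_i ∩ E_j) = exp(-(s_i r_i + (s_j - s_i) r_j)) for
i ≤ j: these are the probabilities that the rectangles [0, s_n] × [0, r_n] contain no point of a
unit-rate Poisson process in the plane.

Let a_n = P(E_n, X_{n+1} > ℓ_n) = w_n P(E_n), where w_n = 1 - F(ℓ_n)^{α_{n+1}}. For small q_n the
series of the a_n and K(ℓ) converge or diverge together (`scheme_weight_le`, `exp_weight_le`).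

If K(ℓ) < ∞, Borel–Cantelli leaves finitely many exits from E_n. Since ℓ is monotone, a late visit
to E_n without a later exit would last forever, which is excluded by P(E_n) → 0.

If K(ℓ) = ∞, a second moment argument is applied to the sum of w_n 1_{E_n}, whose mean over a finite
block is A = ∑ a_n. The weights w_n discount long runs of nearly identical events, so that the
second moment is O(A + A²) (`sum_weighted_joint_le`). Every tail union of the E_n then has
probability at least an absolute constant, and the zero-one law raises this to recurrence almost
surely. The same zero-one law settles the case where s_n q_n is bounded along a subsequence. -/

/-! ### Density estimates behind the second moment bound -/

lemma mul_exp_neg_mul_le {c x : ℝ} (hc : 0 < c) : x * Real.exp (-(c * x)) ≤ 1 / c := by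
  have h1 : c * x ≤ Real.exp (c * x) := by linarith [Real.add_one_le_exp (c * x)]
  rw [Real.exp_neg, ← div_eq_mul_inv, div_le_div_iff₀ (Real.exp_pos _) hc]
  linarith

/-- Integrates a pointwise density bound through explicit antiderivatives. -/
lemma sub_le_sub_of_hasDerivAt_le {f g f' g' : ℝ → ℝ} {a b : ℝ} (hab : a ≤ b)
    (hf : ∀ t, a ≤ t → HasDerivAt f (f' t) t) (hg : ∀ t, a ≤ t → HasDerivAt g (g' t) t)
    (h : ∀ t, a ≤ t → t ≤ b → f' t ≤ g' t) : f b - f a ≤ g b - g a := by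
  have hd : ∀ t, a ≤ t → HasDerivAt (fun t => g t - f t) (g' t - f' t) t :=
    fun t ht => (hg t ht).sub (hf t ht)
  have hm : MonotoneOn (fun t => g t - f t) (Set.Icc a b) := by
    apply monotoneOn_of_deriv_nonneg (convex_Icc a b)
    · exact fun t ht => (hd t ht.1).continuousAt.continuousWithinAt
    · intro t ht
      rw [interior_Icc] at ht
      exact (hd t ht.1.le).differentiableAt.differentiableWithinAt
    · intro t ht
      rw [interior_Icc] at ht
      rw [(hd t ht.1.le).deriv]
      linarith [h t ht.1.le ht.2.le]
  have := hm (Set.left_mem_Icc.2 hab) (Set.right_mem_Icc.2 hab) hab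
  simp only at this
  linarith

/-- Used with σ = s_i, ρ = r_i, r = r_j. For t ≤ 2σ, `hA` gives r ≥ ρ/2. For t > 2σ, (t - σ)r ≥
tr/2; one half of this dominates σρ/4, the other t/(4σ) because r ≥ 1/σ. The bound no longer
involves r and has integral at most 18 over t ≥ σ. -/
lemma forward_density_le {σ ρ r t : ℝ} (hσ : 0 < σ) (hr : r ≤ ρ) (ht : σ ≤ t)
    (hA : σ * ρ ≤ t * r) (h1 : 1 ≤ σ * r) :
    r * Real.exp (-((t - σ) * r)) ≤
      ρ * Real.exp (-(ρ * (t - σ) / 2)) + 4 / σ * Real.exp (-(t / (4 * σ))) := by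
  have hr0 : 0 < r := by
    by_contra! h
    nlinarith
  have hρ0 : 0 < ρ := hr0.trans_le hr
  rcases le_or_gt t (2 * σ) with h2 | h2
  · have h3 : ρ * (t - σ) / 2 ≤ (t - σ) * r := by
      have : ρ / 2 ≤ r := by nlinarith
      nlinarith
    calc r * Real.exp (-((t - σ) * r)) ≤ ρ * Real.exp (-(ρ * (t - σ) / 2)) := by gcongr
      _ ≤ _ := le_add_of_nonneg_right (by positivity)
  · have h3 : t / (4 * σ) ≤ t * r / 4 := by
      rw [div_le_div_iff₀ (by positivity) (by positivity)]
      nlinarith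
    have h4 : 1 / 4 * σ * ρ + t / (4 * σ) ≤ (t - σ) * r := by nlinarith
    have h5 : ρ * Real.exp (-(1 / 4 * σ * ρ)) ≤ 4 / σ := by
      refine (mul_exp_neg_mul_le (by positivity)).trans (le_of_eq ?_)
      field_simp
    calc r * Real.exp (-((t - σ) * r)) ≤ ρ * Real.exp (-(1 / 4 * σ * ρ + t / (4 * σ))) := by gcongr
      _ = ρ * Real.exp (-(1 / 4 * σ * ρ)) * Real.exp (-(t / (4 * σ))) := by
        rw [neg_add, Real.exp_add]; ring
      _ ≤ 4 / σ * Real.exp (-(t / (4 * σ))) := by gcongr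
      _ ≤ _ := le_add_of_nonneg_left (by positivity)

/-- Used with σ = s_j, ρ = r_j, r = r_i. For t ≥ σ/2, `hA` gives r - ρ ≥ ρ(σ - t)/σ. For t < σ/2 it
gives ρ ≤ r/2, so t(r - ρ) ≥ tr/2, and `h1` turns 4/t into 4ρ. The bound has integral at most 18
over [0, σ]. -/
lemma backward_density_le {σ ρ r t : ℝ} (hρ : 0 < ρ) (hr : ρ ≤ r) (ht0 : 0 < t) (ht : t ≤ σ)
    (hA : σ * ρ ≤ t * r) (h1 : 1 ≤ t * ρ) :
    r * Real.exp (-(t * (r - ρ))) ≤ 16 / σ + ρ * Real.exp (-(ρ * (σ - t) / 2)) := by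
  have hσ : 0 < σ := ht0.trans_le ht
  have hr0 : 0 < r := hρ.trans_le hr
  rcases le_or_gt (σ / 2) t with h2 | h2
  · have h3 : 1 / 2 * σ * (r - ρ) ≤ t * (r - ρ) :=
      mul_le_mul_of_nonneg_right (by linarith) (by linarith)
    have h4 : ρ * (σ - t) / 2 ≤ 1 / 2 * σ * (r - ρ) := by nlinarith
    have h5 : (r - ρ) * Real.exp (-(1 / 2 * σ * (r - ρ))) ≤ 16 / σ := by
      refine (mul_exp_neg_mul_le (by positivity)).trans ?_
      rw [div_le_div_iff₀ (by positivity) (by positivity)]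
      linarith
    calc r * Real.exp (-(t * (r - ρ))) ≤ r * Real.exp (-(1 / 2 * σ * (r - ρ))) := by gcongr
      _ = (r - ρ) * Real.exp (-(1 / 2 * σ * (r - ρ))) +
          ρ * Real.exp (-(1 / 2 * σ * (r - ρ))) := by ring
      _ ≤ _ := by gcongr
  · have h3 : 1 / 4 * t * r + 1 / 4 * σ * ρ ≤ t * (r - ρ) := by nlinarith
    have h4 : r * Real.exp (-(1 / 4 * t * r)) ≤ 4 * ρ := by
      refine (mul_exp_neg_mul_le (by positivity)).trans ?_
      rw [div_le_iff₀ (by positivity)]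
      nlinarith
    have h5 : ρ * Real.exp (-(1 / 4 * σ * ρ)) ≤ 4 / σ := by
      refine (mul_exp_neg_mul_le (by positivity)).trans (le_of_eq ?_)
      field_simp
    calc r * Real.exp (-(t * (r - ρ))) ≤ r * Real.exp (-(1 / 4 * t * r + 1 / 4 * σ * ρ)) := by
          gcongr
      _ = r * Real.exp (-(1 / 4 * t * r)) * Real.exp (-(1 / 4 * σ * ρ)) := by
        rw [neg_add, Real.exp_add]; ring
      _ ≤ 4 * ρ * Real.exp (-(1 / 4 * σ * ρ)) := by gcongr
      _ = 4 * (ρ * Real.exp (-(1 / 4 * σ * ρ))) := by ring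
      _ ≤ 4 * (4 / σ) := by gcongr
      _ = 16 / σ := by ring
      _ ≤ _ := le_add_of_nonneg_right (by positivity)

lemma hasDerivAt_exp_affine (a b t : ℝ) :
    HasDerivAt (fun t => Real.exp (a + b * t)) (b * Real.exp (a + b * t)) t := by
  have := (((hasDerivAt_id t).const_mul b).const_add a).exp
  simpa [mul_comm] using this

/-! ### Second moment of the weighted count -/

section SecondMoment

variable {s r : ℕ → ℝ}

/-- The part of the conditional weight of `j` given `i` that is charged to the earlier index `i`. -/
noncomputable def forwardCharge (s r : ℕ → ℝ) (i j : ℕ) : ℝ :=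
  if i < j ∧ s i * r i ≤ s j * r j ∧ 1 ≤ s i * r j then
    (1 - Real.exp (-((s (j + 1) - s j) * r j))) * Real.exp (-((s j - s i) * r j)) else 0

/-- The part of the conditional weight of `i` given `j` that is charged to the later index `j`. -/
noncomputable def backwardCharge (s r : ℕ → ℝ) (i j : ℕ) : ℝ :=
  if i < j ∧ s j * r j ≤ s i * r i ∧ 1 ≤ s i * r j then
    (1 - Real.exp (-((s (i + 1) - s i) * r i))) * Real.exp (-(s i * (r i - r j))) else 0

lemma one_sub_exp_nonneg (hs : Monotone s) (hr : ∀ n, 0 ≤ r n) (n : ℕ) :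
    0 ≤ 1 - Real.exp (-((s (n + 1) - s n) * r n)) := by
  have : 0 ≤ (s (n + 1) - s n) * r n := mul_nonneg (sub_nonneg.2 (hs n.le_succ)) (hr n)
  linarith [Real.exp_le_one_iff.2 (neg_nonpos.2 this)]

lemma one_sub_exp_le_one (n : ℕ) : 1 - Real.exp (-((s (n + 1) - s n) * r n)) ≤ 1 := by
  linarith [Real.exp_pos (-((s (n + 1) - s n) * r n))]

lemma forwardCharge_nonneg (hs : Monotone s) (hr : ∀ n, 0 ≤ r n) (i j : ℕ) :
    0 ≤ forwardCharge s r i j := by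
  unfold forwardCharge
  split_ifs
  · exact mul_nonneg (one_sub_exp_nonneg hs hr j) (Real.exp_pos _).le
  · exact le_rfl

lemma backwardCharge_nonneg (hs : Monotone s) (hr : ∀ n, 0 ≤ r n) (i j : ℕ) :
    0 ≤ backwardCharge s r i j := by
  unfold backwardCharge
  split_ifs
  · exact mul_nonneg (one_sub_exp_nonneg hs hr i) (Real.exp_pos _).le
  · exact le_rfl

/-- Each nonzero charge is the integral of r_j exp(-(t - s_i) r_j) over [s_j, s_{j+1}]. These
intervals do not overlap, so the sum is bounded by one integral of the j-free density over t ≥ s_i.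
-/
lemma sum_forwardCharge_le (hs0 : ∀ n, 0 < s n) (hs : Monotone s) (hr : ∀ n, 0 ≤ r n)
    (hra : Antitone r) (i m : ℕ) : ∑ j ∈ Finset.range m, forwardCharge s r i j ≤ 18 := by
  set Ψ : ℝ → ℝ := fun t => -2 * Real.exp (r i * s i / 2 + -(r i / 2) * t) -
    16 * Real.exp (0 + -(1 / (4 * s i)) * t) with hΨ
  have hΨm : Monotone Ψ := by
    intro a b hab
    have h1 : Real.exp (r i * s i / 2 + -(r i / 2) * b) ≤
        Real.exp (r i * s i / 2 + -(r i / 2) * a) := by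
      refine Real.exp_le_exp.2 ?_
      nlinarith [hr i]
    have h2 : Real.exp (0 + -(1 / (4 * s i)) * b) ≤ Real.exp (0 + -(1 / (4 * s i)) * a) := by
      refine Real.exp_le_exp.2 ?_
      have : 0 < 1 / (4 * s i) := by have := hs0 i; positivity
      nlinarith
    simp only [hΨ]
    linarith
  -- Truncating at s_i keeps the telescoping sum valid for the indices j ≤ i, whose charge is zero.
  have hterm : ∀ j, forwardCharge s r i j ≤ Ψ (max (s i) (s (j + 1))) - Ψ (max (s i) (s j)) := by
    intro j
    unfold forwardCharge
    split_ifs with h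
    · obtain ⟨hij, hA, h1⟩ := h
      rw [max_eq_right (hs hij.le), max_eq_right (hs (hij.le.trans j.le_succ))]
      have key := sub_le_sub_of_hasDerivAt_le (a := s j) (b := s (j + 1)) (hs j.le_succ)
        (f := fun t => -Real.exp (s i * r j + -(r j) * t)) (g := Ψ)
        (fun t _ => (hasDerivAt_exp_affine _ _ t).neg)
        (fun t _ => ((hasDerivAt_exp_affine _ _ t).const_mul (-2)).sub
          ((hasDerivAt_exp_affine _ _ t).const_mul 16)) (by
          intro t ht _
          have hst : s i ≤ t := (hs hij.le).trans ht
          have := forward_density_le (hs0 i) (hra hij.le) hst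
            (hA.trans (mul_le_mul_of_nonneg_right ht (hr j))) h1
          rw [show s i * r j + -(r j) * t = -((t - s i) * r j) by ring,
            show r i * s i / 2 + -(r i / 2) * t = -(r i * (t - s i) / 2) by ring,
            show 0 + -(1 / (4 * s i)) * t = -(t / (4 * s i)) by ring]
          have e : -2 * (-(r i / 2) * Real.exp (-(r i * (t - s i) / 2))) -
              16 * (-(1 / (4 * s i)) * Real.exp (-(t / (4 * s i)))) =
              r i * Real.exp (-(r i * (t - s i) / 2)) +
                4 / s i * Real.exp (-(t / (4 * s i))) := by
            have := (hs0 i).ne'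
            field_simp
            ring
          linarith)
      refine le_trans (le_of_eq ?_) key
      have e : Real.exp (s i * r j + -(r j) * s (j + 1)) =
          Real.exp (-((s (j + 1) - s j) * r j)) * Real.exp (-((s j - s i) * r j)) := by
        rw [← Real.exp_add]; congr 1; ring
      rw [e, show s i * r j + -(r j) * s j = -((s j - s i) * r j) by ring]
      ring
    · exact sub_nonneg.2 (hΨm (max_le_max le_rfl (hs j.le_succ)))
  calc ∑ j ∈ Finset.range m, forwardCharge s r i j
      ≤ ∑ j ∈ Finset.range m, (Ψ (max (s i) (s (j + 1))) - Ψ (max (s i) (s j))) :=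
        Finset.sum_le_sum fun j _ => hterm j
    _ = Ψ (max (s i) (s m)) - Ψ (max (s i) (s 0)) :=
        Finset.sum_range_sub (fun j => Ψ (max (s i) (s j))) m
    _ ≤ 0 - Ψ (s i) := by
        have h1 : Ψ (max (s i) (s m)) ≤ 0 := by
          simp only [hΨ]
          linarith [Real.exp_pos (r i * s i / 2 + -(r i / 2) * max (s i) (s m)),
            Real.exp_pos (0 + -(1 / (4 * s i)) * max (s i) (s m))]
        linarith [hΨm (le_max_left (s i) (s 0))]
    _ ≤ 18 := by
        simp only [hΨ]
        have h1 : Real.exp (r i * s i / 2 + -(r i / 2) * s i) ≤ 1 :=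
          Real.exp_le_one_iff.2 (by linarith)
        have h2 : Real.exp (0 + -(1 / (4 * s i)) * s i) ≤ 1 := by
          refine Real.exp_le_one_iff.2 ?_
          have : 0 < 1 / (4 * s i) * s i := by have := hs0 i; positivity
          linarith
        linarith

/-- Mirror image of the forward bound: the charges are integrals over the disjoint intervals [s_i,
s_{i+1}] inside [0, s_j]. -/
lemma sum_backwardCharge_le (hs0 : ∀ n, 0 < s n) (hs : Monotone s) (hr : ∀ n, 0 ≤ r n)
    (hra : Antitone r) (j m : ℕ) : ∑ i ∈ Finset.range m, backwardCharge s r i j ≤ 18 := by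
  set Ψ : ℝ → ℝ := fun t => 16 / s j * t + 2 * Real.exp (-(r j * s j / 2) + r j / 2 * t) with hΨ
  have hj := hs0 j
  have hΨm : Monotone Ψ := by
    intro a b hab
    have h1 : Real.exp (-(r j * s j / 2) + r j / 2 * a) ≤
        Real.exp (-(r j * s j / 2) + r j / 2 * b) := by
      refine Real.exp_le_exp.2 ?_
      nlinarith [hr j]
    have h2 : 16 / s j * a ≤ 16 / s j * b := by gcongr
    simp only [hΨ]
    linarith
  have hterm : ∀ i, backwardCharge s r i j ≤ Ψ (min (s j) (s (i + 1))) - Ψ (min (s j) (s i)) := by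
    intro i
    unfold backwardCharge
    split_ifs with h
    · obtain ⟨hij, hA, h1⟩ := h
      rw [min_eq_right (hs hij.le), min_eq_right (hs hij)]
      have key := sub_le_sub_of_hasDerivAt_le (a := s i) (b := s (i + 1)) (hs i.le_succ)
        (f := fun t => -Real.exp (s i * r j + -(r i) * t)) (g := Ψ)
        (fun t _ => (hasDerivAt_exp_affine _ _ t).neg)
        (fun t _ => ((hasDerivAt_id t).const_mul (16 / s j)).add
          ((hasDerivAt_exp_affine _ _ t).const_mul 2)) (by
          intro t ht ht'
          have hst : t ≤ s j := ht'.trans (hs hij)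
          have hri : 0 < r j := by
            by_contra! h
            nlinarith [hs0 i]
          have := backward_density_le hri (hra hij.le) ((hs0 i).trans_le ht) hst
            (hA.trans (mul_le_mul_of_nonneg_right ht (hr i)))
            (h1.trans (mul_le_mul_of_nonneg_right ht (hr j)))
          rw [show -(r j * s j / 2) + r j / 2 * t = -(r j * (s j - t) / 2) by ring]
          have h5 : r i * Real.exp (s i * r j + -(r i) * t) ≤
              r i * Real.exp (-(t * (r i - r j))) := by
            refine mul_le_mul_of_nonneg_left (Real.exp_le_exp.2 ?_) (hr i)
            nlinarith
          linarith)
      refine le_trans (le_of_eq ?_) key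
      have e : Real.exp (s i * r j + -(r i) * s (i + 1)) =
          Real.exp (-((s (i + 1) - s i) * r i)) * Real.exp (-(s i * (r i - r j))) := by
        rw [← Real.exp_add]; congr 1; ring
      rw [e, show s i * r j + -(r i) * s i = -(s i * (r i - r j)) by ring]
      ring
    · exact sub_nonneg.2 (hΨm (min_le_min le_rfl (hs i.le_succ)))
  calc ∑ i ∈ Finset.range m, backwardCharge s r i j
      ≤ ∑ i ∈ Finset.range m, (Ψ (min (s j) (s (i + 1))) - Ψ (min (s j) (s i))) :=
        Finset.sum_le_sum fun j _ => hterm j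
    _ = Ψ (min (s j) (s m)) - Ψ (min (s j) (s 0)) :=
        Finset.sum_range_sub (fun i => Ψ (min (s j) (s i))) m
    _ ≤ Ψ (s j) - 0 := by
        have h1 : 0 ≤ Ψ (min (s j) (s 0)) := by
          have := lt_min (hs0 j) (hs0 0)
          simp only [hΨ]
          positivity
        linarith [hΨm (min_le_left (s j) (s m))]
    _ ≤ 18 := by
        simp only [hΨ]
        have h1 : Real.exp (-(r j * s j / 2) + r j / 2 * s j) ≤ 1 :=
          Real.exp_le_one_iff.2 (by linarith)
        have h2 : 16 / s j * s j = 16 := by field_simp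
        linarith

/-- P(E_i ∩ E_j) = exp(s_i r_j) P(E_i) P(E_j), where s_i r_j is the area common to both rectangles.
If it is at most 1, the events are independent up to a factor e ≤ 3. Otherwise the pair is charged
to the rectangle of smaller area, the remaining factor being the weighted conditional probability of
the other event. -/
lemma weighted_joint_le_of_lt (hs : Monotone s) (hr : ∀ n, 0 ≤ r n)
    {i j : ℕ} (hij : i < j) {w a : ℕ → ℝ}
    (hw : ∀ n, w n = 1 - Real.exp (-((s (n + 1) - s n) * r n)))
    (ha : ∀ n, a n = w n * Real.exp (-(s n * r n))) :
    w i * w j * Real.exp (-(s i * r i + (s j - s i) * r j)) ≤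
      3 * (a i * a j) + a i * forwardCharge s r i j + a j * backwardCharge s r i j := by
  have hw0 : ∀ n, 0 ≤ w n := fun n => (hw n).symm ▸ one_sub_exp_nonneg hs hr n
  have hw1 : ∀ n, w n ≤ 1 := fun n => (hw n).symm ▸ one_sub_exp_le_one n
  have ha0 : ∀ n, 0 ≤ a n := fun n => (ha n).symm ▸ mul_nonneg (hw0 n) (Real.exp_pos _).le
  have n1 : 0 ≤ 3 * (a i * a j) := by have := ha0 i; have := ha0 j; positivity
  have n2 : 0 ≤ a i * forwardCharge s r i j := mul_nonneg (ha0 i) (forwardCharge_nonneg hs hr i j)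
  have n3 : 0 ≤ a j * backwardCharge s r i j :=
    mul_nonneg (ha0 j) (backwardCharge_nonneg hs hr i j)
  rcases le_total (s i * r j) 1 with h | h
  · have h3 : Real.exp (s i * r j) ≤ 3 :=
      (Real.exp_le_exp.2 h).trans (by linarith [Real.exp_one_lt_d9])
    have e : w i * w j * Real.exp (-(s i * r i + (s j - s i) * r j)) =
        Real.exp (s i * r j) * (a i * a j) := by
      have : Real.exp (-(s i * r i + (s j - s i) * r j)) =
        Real.exp (s i * r j) * (Real.exp (-(s i * r i)) * Real.exp (-(s j * r j))) := by
        rw [← Real.exp_add, ← Real.exp_add]; congr 1; ring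
      rw [this, ha, ha]; ring
    have : Real.exp (s i * r j) * (a i * a j) ≤ 3 * (a i * a j) :=
      mul_le_mul_of_nonneg_right h3 (mul_nonneg (ha0 i) (ha0 j))
    linarith
  · rcases le_total (s i * r i) (s j * r j) with h' | h'
    · have e : w i * w j * Real.exp (-(s i * r i + (s j - s i) * r j)) =
          a i * forwardCharge s r i j := by
        rw [forwardCharge, if_pos ⟨hij, h', h⟩, ← hw, ha, neg_add, Real.exp_add]; ring
      linarith
    · have e : w i * w j * Real.exp (-(s i * r i + (s j - s i) * r j)) =
          a j * backwardCharge s r i j := by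
        have : Real.exp (-(s i * r i + (s j - s i) * r j)) =
            Real.exp (-(s j * r j)) * Real.exp (-(s i * (r i - r j))) := by
          rw [← Real.exp_add]; congr 1; ring
        rw [backwardCharge, if_pos ⟨hij, h', h⟩, ← hw, ha, this]; ring
      linarith

/-- Second moment bound for the weighted number of empty rectangles `[0, s n] × [0, r n]`. -/
lemma sum_weighted_joint_le (hs0 : ∀ n, 0 < s n) (hs : Monotone s) (hr : ∀ n, 0 ≤ r n)
    (hra : Antitone r) {w a : ℕ → ℝ}
    (hw : ∀ n, w n = 1 - Real.exp (-((s (n + 1) - s n) * r n)))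
    (ha : ∀ n, a n = w n * Real.exp (-(s n * r n))) {J : ℕ → ℕ → ℝ}
    (hJs : ∀ i j, J i j = J j i)
    (hJ : ∀ i j, i ≤ j → J i j = Real.exp (-(s i * r i + (s j - s i) * r j))) (m : ℕ) :
    ∑ i ∈ Finset.range m, ∑ j ∈ Finset.range m, w i * w j * J i j ≤
      80 * (∑ n ∈ Finset.range m, a n + (∑ n ∈ Finset.range m, a n) ^ 2) := by
  have hw0 : ∀ n, 0 ≤ w n := fun n => (hw n).symm ▸ one_sub_exp_nonneg hs hr n
  have hw1 : ∀ n, w n ≤ 1 := fun n => (hw n).symm ▸ one_sub_exp_le_one n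
  have ha0 : ∀ n, 0 ≤ a n := fun n => (ha n).symm ▸ mul_nonneg (hw0 n) (Real.exp_pos _).le
  have n1 : ∀ i j, 0 ≤ a i * a j := fun i j => mul_nonneg (ha0 i) (ha0 j)
  have n2 : ∀ i j, 0 ≤ a i * forwardCharge s r i j :=
    fun i j => mul_nonneg (ha0 i) (forwardCharge_nonneg hs hr i j)
  have n3 : ∀ i j, 0 ≤ a j * backwardCharge s r i j :=
    fun i j => mul_nonneg (ha0 j) (backwardCharge_nonneg hs hr i j)
  have hterm : ∀ i j, w i * w j * J i j ≤ 3 * (a i * a j) +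
      (a i * forwardCharge s r i j + a j * backwardCharge s r i j) +
      (a j * forwardCharge s r j i + a i * backwardCharge s r j i) + if i = j then a i else 0 := by
    intro i j
    rcases lt_trichotomy i j with h | h | h
    · rw [hJ i j h.le, if_neg h.ne]
      linarith [weighted_joint_le_of_lt hs hr h hw ha, n2 j i, n3 j i]
    · subst h
      rw [hJ i i le_rfl, if_pos rfl]
      have e : w i * w i * Real.exp (-(s i * r i + (s i - s i) * r i)) = w i * a i := by
        rw [ha]; simp; ring
      have : w i * a i ≤ a i := mul_le_of_le_one_left (ha0 i) (hw1 i)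
      linarith [n1 i i, n2 i i, n3 i i]
    · rw [hJs, hJ j i h.le, if_neg h.ne', mul_comm (w i)]
      linarith [weighted_joint_le_of_lt hs hr h hw ha, n2 i j, n3 i j, mul_comm (a i) (a j)]
  set A := ∑ n ∈ Finset.range m, a n with hA
  have hA0 : 0 ≤ A := Finset.sum_nonneg fun n _ => ha0 n
  have s1 : ∑ i ∈ Finset.range m, ∑ j ∈ Finset.range m, 3 * (a i * a j) = 3 * A ^ 2 := by
    simp_rw [← Finset.mul_sum, ← Finset.sum_mul]
    ring
  have s2 : ∑ i ∈ Finset.range m, ∑ j ∈ Finset.range m, a i * forwardCharge s r i j ≤ 18 * A := by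
    simp_rw [← Finset.mul_sum]
    rw [hA, Finset.mul_sum]
    refine Finset.sum_le_sum fun i _ => ?_
    rw [mul_comm 18]
    exact mul_le_mul_of_nonneg_left (sum_forwardCharge_le hs0 hs hr hra i m) (ha0 i)
  have s3 : ∑ i ∈ Finset.range m, ∑ j ∈ Finset.range m, a i * backwardCharge s r j i ≤ 18 * A := by
    simp_rw [← Finset.mul_sum]
    rw [hA, Finset.mul_sum]
    refine Finset.sum_le_sum fun i _ => ?_
    rw [mul_comm 18]
    exact mul_le_mul_of_nonneg_left (sum_backwardCharge_le hs0 hs hr hra i m) (ha0 i)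
  have s2' : ∑ i ∈ Finset.range m, ∑ j ∈ Finset.range m, a j * forwardCharge s r j i ≤ 18 * A := by
    rw [Finset.sum_comm]; exact s2
  have s3' : ∑ i ∈ Finset.range m, ∑ j ∈ Finset.range m, a j * backwardCharge s r i j ≤ 18 * A := by
    rw [Finset.sum_comm]; exact s3
  have s4 : ∑ i ∈ Finset.range m, ∑ j ∈ Finset.range m, (if i = j then a i else 0) = A := by
    refine Finset.sum_congr rfl fun i hi => ?_
    rw [Finset.sum_ite_eq, if_pos hi]
  calc _ ≤ _ := Finset.sum_le_sum fun i _ => Finset.sum_le_sum fun j _ => hterm i j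
    -- The total is 3A² + 4 · 18A + A, the last A from the diagonal.
    _ ≤ 80 * (A + A ^ 2) := by
      simp only [Finset.sum_add_distrib]
      rw [s1, s4]
      nlinarith [sq_nonneg A]

end SecondMoment

/-! ### Comparing K(ℓ) with the transition probabilities -/

lemma neg_log_one_sub_le {q : ℝ} (h0 : 0 ≤ q) (h1 : q ≤ 1 / 2) :
    -Real.log (1 - q) ≤ q + q ^ 2 := by
  have h2 : 0 < 1 - q := by linarith
  have h3 := Real.log_le_sub_one_of_pos (x := Real.exp (-(q + q ^ 2)) / (1 - q))
    (div_pos (Real.exp_pos _) h2)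
  rw [Real.log_div (Real.exp_pos _).ne' h2.ne', Real.log_exp] at h3
  have h4 : Real.exp (-(q + q ^ 2)) ≤ 1 - q := by
    rw [Real.exp_neg, inv_le_comm₀ (Real.exp_pos _) h2]
    refine le_trans ?_ (Real.quadratic_le_exp_of_nonneg (by positivity))
    rw [inv_le_iff_one_le_mul₀ h2]
    nlinarith [pow_nonneg h0 2, pow_nonneg h0 3, pow_nonneg h0 4, pow_nonneg h0 5]
  have : Real.exp (-(q + q ^ 2)) / (1 - q) ≤ 1 := (div_le_one h2).2 h4
  linarith

lemma exp_neg_two_mul_le_one_sub {q : ℝ} (h0 : 0 ≤ q) (h1 : q ≤ 1 / 2) :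
    Real.exp (-(2 * q)) ≤ 1 - q := by
  rw [← Real.le_log_iff_exp_le (by linarith)]
  nlinarith [neg_log_one_sub_le h0 h1]

/-- Large values of `q` contribute at most a telescoping amount to the series. -/
lemma exp_neg_mul_sub_le_inv_sub {u v q : ℝ} (hu : Real.exp 1 ≤ u) (huv : u ≤ v)
    (h1 : q ≤ 1) (hq : 2 * Real.log u ≤ u * q) :
    Real.exp (-(u * q)) * (1 - Real.exp (-((v - u) * q))) ≤ u⁻¹ - v⁻¹ := by
  have hu0 : 0 < u := (Real.exp_pos 1).trans_le hu
  have key := sub_le_sub_of_hasDerivAt_le (a := u) (b := v) huv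
    (f := fun t => -Real.exp (0 + -q * t)) (g := fun t => -t⁻¹)
    (fun t _ => (hasDerivAt_exp_affine _ _ t).neg)
    (fun t ht => (hasDerivAt_inv (hu0.trans_le ht).ne').neg) (by
      intro t ht _
      -- As log t / t decreases beyond e, the bound 2 log t ≤ tq passes from u to all of [u, v],
      -- giving q exp(-qt) ≤ t⁻².
      have ht0 : 0 < t := hu0.trans_le ht
      have h2 : Real.log t / t ≤ Real.log u / u :=
        Real.log_div_self_antitoneOn hu (hu.trans ht) ht
      have h3 : Real.log u / u ≤ q / 2 := by
        rw [div_le_div_iff₀ hu0 two_pos]; linarith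
      have h4 : 2 * Real.log t ≤ t * q := by
        have := (div_le_iff₀ ht0).1 (h2.trans h3)
        linarith
      have h5 : Real.exp (0 + -q * t) ≤ (t ^ 2)⁻¹ := by
        rw [← Real.exp_log (inv_pos.2 (pow_pos ht0 2)), Real.log_inv, Real.log_pow]
        refine Real.exp_le_exp.2 ?_
        push_cast
        linarith
      have h6 : q * Real.exp (0 + -q * t) ≤ Real.exp (0 + -q * t) :=
        mul_le_of_le_one_left (Real.exp_pos _).le h1
      linarith)
  have e : Real.exp (0 + -q * v) = Real.exp (-(u * q)) * Real.exp (-((v - u) * q)) := by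
    rw [← Real.exp_add]; congr 1; ring
  rw [e, show 0 + -q * u = -(u * q) by ring] at key
  linarith

lemma sq_log_le {u : ℝ} (hu : 1 ≤ u) : Real.log u ^ 2 ≤ 4 * u := by
  have h0 : 0 < u := by linarith
  have h1 : Real.log u ≤ 2 * √u := by
    have := Real.log_le_sub_one_of_pos (Real.sqrt_pos.2 h0)
    rw [Real.log_sqrt h0.le] at this
    linarith
  have h2 := Real.log_nonneg hu
  nlinarith [Real.sq_sqrt h0.le, Real.sqrt_nonneg u]

/-- Comparison of the exponential weights with the weights of an `F^α`-scheme. -/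
lemma exp_weight_le {u v q : ℝ} (hu : Real.exp 1 ≤ u) (huv : u ≤ v) (h0 : 0 ≤ q)
    (h1 : q ≤ 1 / 2) :
    Real.exp (-(u * q)) * (1 - Real.exp (-((v - u) * q))) ≤
      Real.exp 16 * ((1 - q) ^ u * (1 - (1 - q) ^ (v - u))) + (u⁻¹ - v⁻¹) := by
  have hu1 : 1 ≤ u := le_trans (by linarith [Real.add_one_le_exp 1]) hu
  have hu0 : 0 < u := by linarith
  have hq1 : 0 < 1 - q := by linarith
  have hl : Real.log (1 - q) ≤ -q := by linarith [Real.log_le_sub_one_of_pos hq1]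
  have n1 : (1 - q) ^ (v - u) ≤ 1 := Real.rpow_le_one hq1.le (by linarith) (by linarith)
  have n2 : 0 ≤ (1 - q) ^ u * (1 - (1 - q) ^ (v - u)) :=
    mul_nonneg (Real.rpow_nonneg hq1.le _) (by linarith)
  have n3 : 0 ≤ u⁻¹ - v⁻¹ := sub_nonneg.2 (inv_anti₀ hu0 huv)
  -- Either q is large and the telescoping bound applies, or uq² ≤ 4 (log u)² / u ≤ 16, which bounds
  -- the cost of replacing exp(-uq) by (1 - q)^u.
  rcases le_total (2 * Real.log u) (u * q) with h | h
  · have := exp_neg_mul_sub_le_inv_sub hu huv (by linarith) h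
    have : 0 ≤ Real.exp 16 * ((1 - q) ^ u * (1 - (1 - q) ^ (v - u))) :=
      mul_nonneg (Real.exp_pos _).le n2
    linarith
  · have h2 : u * q ^ 2 ≤ 16 := by
      have h3 : (u * q) ^ 2 ≤ (2 * Real.log u) ^ 2 := by gcongr
      have h4 := sq_log_le hu1
      have h5 : u * (u * q ^ 2) ≤ u * 16 := by nlinarith
      exact le_of_mul_le_mul_left h5 hu0
    have h3 : Real.exp (-(u * q)) ≤ Real.exp 16 * (1 - q) ^ u := by
      rw [Real.rpow_def_of_pos hq1, ← Real.exp_add]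
      refine Real.exp_le_exp.2 ?_
      have := neg_log_one_sub_le h0 h1
      nlinarith
    have h4 : (1 - q) ^ (v - u) ≤ Real.exp (-((v - u) * q)) := by
      rw [Real.rpow_def_of_pos hq1]
      refine Real.exp_le_exp.2 ?_
      nlinarith
    have h5 : Real.exp (-(u * q)) * (1 - Real.exp (-((v - u) * q))) ≤
        Real.exp 16 * (1 - q) ^ u * (1 - (1 - q) ^ (v - u)) := by
      apply mul_le_mul h3 (by linarith)
      · have : 0 ≤ (v - u) * q := mul_nonneg (by linarith) h0
        linarith [Real.exp_le_one_iff.2 (neg_nonpos.2 this)]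
      · exact mul_nonneg (Real.exp_pos _).le (Real.rpow_nonneg hq1.le _)
    linarith [mul_assoc (Real.exp 16) ((1 - q) ^ u) (1 - (1 - q) ^ (v - u))]

/-- The reverse comparison. -/
lemma scheme_weight_le {u a q : ℝ} (hu : 0 ≤ u) (ha : 0 ≤ a) (h0 : 0 ≤ q) (h1 : q ≤ 1 / 2) :
    (1 - q) ^ u * (1 - (1 - q) ^ a) ≤
      2 * (Real.exp (-(u * q)) * (1 - Real.exp (-(a * q)))) := by
  have hq1 : 0 < 1 - q := by linarith
  have hl : Real.log (1 - q) ≤ -q := by linarith [Real.log_le_sub_one_of_pos hq1]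
  have h2 : (1 - q) ^ u ≤ Real.exp (-(u * q)) := by
    rw [Real.rpow_def_of_pos hq1]
    exact Real.exp_le_exp.2 (by nlinarith)
  have h3 : Real.exp (-(a * q)) ^ 2 ≤ (1 - q) ^ a := by
    calc Real.exp (-(a * q)) ^ 2 = Real.exp (-(2 * q)) ^ a := by
          rw [← Real.exp_mul, ← Real.exp_nat_mul]; congr 1; push_cast; ring
      _ ≤ (1 - q) ^ a :=
          Real.rpow_le_rpow (Real.exp_pos _).le (exp_neg_two_mul_le_one_sub h0 h1) ha
  have h4 : 1 - (1 - q) ^ a ≤ 2 * (1 - Real.exp (-(a * q))) := by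
    nlinarith [sq_nonneg (1 - Real.exp (-(a * q)))]
  have h5 : 0 ≤ 1 - (1 - q) ^ a := by
    linarith [Real.rpow_le_one hq1.le (by linarith) ha]
  calc _ ≤ Real.exp (-(u * q)) * (2 * (1 - Real.exp (-(a * q)))) := by
        exact mul_le_mul h2 h4 h5 (Real.exp_pos _).le
    _ = _ := by ring

/-! ### Kochen–Stone inequality and zero-one law -/

/-- Weighted Kochen–Stone inequality: a second moment bound forces the union to have
probability bounded below. -/
lemma le_measureReal_biUnion_of_second_moment {Ω : Type*} [MeasurableSpace Ω] {μ : Measure Ω}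
    [IsProbabilityMeasure μ] {E : ℕ → Set Ω} (hE : ∀ n, MeasurableSet (E n)) {w : ℕ → ℝ}
    {C A : ℝ} (hC : 0 < C) (m : ℕ)
    (hA : ∑ n ∈ Finset.range m, w n * μ.real (E n) = A) (hA1 : 1 ≤ A)
    (h2 : ∑ i ∈ Finset.range m, ∑ j ∈ Finset.range m, w i * w j * μ.real (E i ∩ E j) ≤
      C * (A + A ^ 2)) :
    1 / (2 * C) ≤ μ.real (⋃ n ∈ Finset.range m, E n) := by
  set U := ⋃ n ∈ Finset.range m, E n with hU
  have hUm : MeasurableSet U := Finset.measurableSet_biUnion _ fun n _ => hE n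
  set N : Ω → ℝ := fun ω => ∑ n ∈ Finset.range m, w n * (E n).indicator 1 ω with hN
  have hi : ∀ {S : Set Ω}, MeasurableSet S → Integrable (S.indicator (1 : Ω → ℝ)) μ :=
    fun hS => (integrable_const (1 : ℝ)).indicator hS
  have hNsq : ∀ ω, N ω ^ 2 = ∑ i ∈ Finset.range m, ∑ j ∈ Finset.range m,
      w i * w j * (E i ∩ E j).indicator 1 ω := by
    intro ω
    simp only [hN]
    rw [sq, Finset.sum_mul_sum]
    refine Finset.sum_congr rfl fun i _ => Finset.sum_congr rfl fun j _ => ?_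
    rw [Set.inter_indicator_one]
    simp only [Pi.mul_apply]
    ring
  have hNi : Integrable N μ := integrable_finsetSum _ fun n _ => (hi (hE n)).const_mul _
  have hNsqi : Integrable (fun ω => N ω ^ 2) μ := by
    simp_rw [hNsq]
    exact integrable_finsetSum _ fun i _ => integrable_finsetSum _ fun j _ =>
      (hi ((hE i).inter (hE j))).const_mul _
  have e1 : ∫ ω, N ω ∂μ = A := by
    rw [← hA]
    simp only [hN]
    rw [integral_finsetSum _ fun n _ => (hi (hE n)).const_mul _]
    refine Finset.sum_congr rfl fun n _ => ?_
    rw [integral_const_mul, integral_indicator_one (hE n)]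
  have e2 : ∫ ω, N ω ^ 2 ∂μ ≤ C * (A + A ^ 2) := by
    refine le_trans (le_of_eq ?_) h2
    simp_rw [hNsq]
    rw [integral_finsetSum _ fun i _ => integrable_finsetSum _ fun j _ =>
      (hi ((hE i).inter (hE j))).const_mul _]
    refine Finset.sum_congr rfl fun i _ => ?_
    rw [integral_finsetSum _ fun j _ => (hi ((hE i).inter (hE j))).const_mul _]
    refine Finset.sum_congr rfl fun j _ => ?_
    rw [integral_const_mul, integral_indicator_one ((hE i).inter (hE j))]
  have hA0 : 0 < A := by linarith
  -- AM–GM on U, where N is supported. The coefficients make the quadratic term integrate to at most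
  -- A/2, using A ≤ A².
  have hpt : ∀ ω, N ω ≤ (1 / (4 * C * A)) * N ω ^ 2 + C * A * U.indicator 1 ω := by
    intro ω
    by_cases hω : ω ∈ U
    · rw [Set.indicator_of_mem hω]
      have hp : 0 < 4 * C * A := by positivity
      have h3 := sq_nonneg (N ω - 2 * C * A)
      have h4 : 1 / (4 * C * A) * N ω ^ 2 + C * A * 1 - N ω =
          (N ω - 2 * C * A) ^ 2 / (4 * C * A) := by
        field_simp
        ring
      have h5 : 0 ≤ (N ω - 2 * C * A) ^ 2 / (4 * C * A) := by positivity
      simp only [Pi.one_apply]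
      linarith
    · have h0 : N ω = 0 := by
        refine Finset.sum_eq_zero fun n hn => ?_
        rw [Set.indicator_of_notMem, mul_zero]
        exact fun h => hω (Set.mem_biUnion hn h)
      rw [h0, Set.indicator_of_notMem hω]
      simp
  have key := integral_mono hNi ((hNsqi.const_mul _).add ((hi hUm).const_mul _)) hpt
  simp only [Pi.add_apply] at key
  rw [integral_add (hNsqi.const_mul _) ((hi hUm).const_mul _), integral_const_mul,
    integral_const_mul, integral_indicator_one hUm, e1] at key
  have h6 : 1 / (4 * C * A) * ∫ ω, N ω ^ 2 ∂μ ≤ A / 2 := by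
    calc _ ≤ 1 / (4 * C * A) * (C * (A + A ^ 2)) := by gcongr
      _ ≤ 1 / (4 * C * A) * (C * (A ^ 2 + A ^ 2)) := by gcongr; nlinarith
      _ = A / 2 := by field_simp; ring
  rw [div_le_iff₀ (by positivity)]
  have h7 : A * 1 ≤ A * (μ.real U * (2 * C)) := by nlinarith
  exact le_of_mul_le_mul_left h7 hA0

lemma le_measure_frequently {Ω : Type*} [MeasurableSpace Ω] {μ : Measure Ω} [IsFiniteMeasure μ]
    {E : ℕ → Set Ω} (hE : ∀ n, MeasurableSet (E n)) {δ : ℝ≥0∞}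
    (h : ∀ N, δ ≤ μ (⋃ n ≥ N, E n)) : δ ≤ μ {ω | ∃ᶠ n in atTop, ω ∈ E n} := by
  have e : {ω | ∃ᶠ n in atTop, ω ∈ E n} = ⋂ N, ⋃ n ≥ N, E n := by
    ext ω
    simp [frequently_atTop]
  have ha : Antitone fun N => ⋃ n ≥ N, E n :=
    fun a b hab => Set.biUnion_subset_biUnion_left fun n hn => le_trans hab hn
  rw [e, ha.measure_iInter (fun N =>
    (MeasurableSet.biUnion (Set.to_countable _) fun n _ => hE n).nullMeasurableSet)
    ⟨0, measure_ne_top _ _⟩]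
  exact le_iInf h

/-- Zero-one law for the recurrence of `max (X 0, …, X n) ≤ ℓ n`. -/
lemma measure_frequently_forall_le_eq_zero_or_one {Ω : Type*} [MeasurableSpace Ω]
    {μ : Measure Ω} [IsProbabilityMeasure μ] {X : ℕ → Ω → ℝ} (hXm : ∀ n, Measurable (X n))
    (hXi : iIndepFun X μ) {ℓ : ℕ → ℝ} (hℓ : Monotone ℓ)
    (h : ∀ j, ∀ᵐ ω ∂μ, ∃ n, X j ω ≤ ℓ n) :
    μ {ω | ∃ᶠ n in atTop, ∀ j ≤ n, X j ω ≤ ℓ n} = 0 ∨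
      μ {ω | ∃ᶠ n in atTop, ∀ j ≤ n, X j ω ≤ ℓ n} = 1 := by
  set T : ℕ → Set Ω := fun k => {ω | ∃ᶠ n in atTop, ∀ j, k ≤ j → j ≤ n → X j ω ≤ ℓ n} with hT
  have hTm : Monotone T := fun a b hab ω hω =>
    hω.mono fun n hn j hj => hn j (hab.trans hj)
  -- Almost surely each X_j is eventually below ℓ_n, so any finite set of indices can be ignored and
  -- the event is a tail event up to a null set.
  have hae : {ω | ∃ᶠ n in atTop, ∀ j ≤ n, X j ω ≤ ℓ n} =ᵐ[μ] ⋃ k, T k := by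
    filter_upwards [ae_all_iff.2 h] with ω hω
    refine propext ⟨fun h0 => Set.mem_iUnion.2 ⟨0, ?_⟩, fun hk => ?_⟩
    · exact Frequently.mono h0 fun n hn j _ => hn j
    · obtain ⟨k, hk⟩ := Set.mem_iUnion.1 hk
      have hev : ∀ᶠ n in atTop, ∀ j ∈ Finset.range k, X j ω ≤ ℓ n := by
        rw [eventually_all_finset]
        intro j _
        obtain ⟨n, hn⟩ := hω j
        filter_upwards [eventually_ge_atTop n] with p hp
        exact hn.trans (hℓ hp)
      refine (Frequently.and_eventually hk hev).mono fun n hn j hj => ?_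
      rcases lt_or_ge j k with hjk | hjk
      · exact hn.2 j (Finset.mem_range.2 hjk)
      · exact hn.1 j hjk hj
  rw [measure_congr hae]
  refine measure_zero_or_one_of_measurableSet_limsup_atTop
    (s := fun n => MeasurableSpace.comap (X n) inferInstance)
    (fun n => (hXm n).comap_le) hXi ?_
  rw [limsup_eq_iInf_iSup_of_nat, MeasurableSpace.measurableSet_iInf]
  intro m
  have e : ⋃ k, T k = ⋃ k, T (k + m) := by
    refine Set.Subset.antisymm (Set.iUnion_subset fun k => ?_) (Set.iUnion_subset fun k => ?_)
    · exact (hTm (Nat.le_add_right k m)).trans (Set.subset_iUnion (fun k => T (k + m)) k)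
    · exact Set.subset_iUnion T (k + m)
  rw [e]
  refine MeasurableSet.iUnion fun k => ?_
  have e2 : T (k + m) = ⋂ N : ℕ, ⋃ n : ℕ, ⋃ _ : N ≤ n, ⋂ j : ℕ, ⋂ _ : k + m ≤ j, ⋂ _ : j ≤ n,
      X j ⁻¹' Set.Iic (ℓ n) := by
    ext ω
    simp [hT, frequently_atTop]
  rw [e2]
  refine MeasurableSet.iInter fun N => MeasurableSet.iUnion fun n => MeasurableSet.iUnion fun _ =>
    MeasurableSet.iInter fun j => MeasurableSet.iInter fun hj => MeasurableSet.iInter fun _ => ?_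
  have hle : MeasurableSpace.comap (X j) inferInstance ≤
      ⨆ i ≥ m, MeasurableSpace.comap (X i) inferInstance :=
    le_iSup₂_of_le j (by omega) le_rfl
  exact hle _ ⟨Set.Iic (ℓ n), measurableSet_Iic, rfl⟩

/-! ### Exact probabilities for the scheme -/

section Scheme

variable {Ω : Type*} [MeasurableSpace Ω] {μ : Measure Ω}
  {ν : Measure ℝ} {α : ℕ → ℝ} {X : ℕ → Ω → ℝ} {ℓ : ℕ → ℝ}

/-- The event that `max (X 0, …, X n) ≤ x`. -/
def maxLE {Ω : Type*} (X : ℕ → Ω → ℝ) (n : ℕ) (x : ℝ) : Set Ω := {ω | ∀ k ≤ n, X k ω ≤ x}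

lemma eventuallyAbove_compl {Ω : Type*} (X : ℕ → Ω → ℝ) (ℓ : ℕ → ℝ) :
    (eventuallyAbove X ℓ)ᶜ = {ω | ∃ᶠ n in atTop, ω ∈ maxLE X n (ℓ n)} := by
  ext ω
  simp [eventuallyAbove, partialMax, maxLE, frequently_atTop]

lemma measurableSet_maxLE (hX : ∀ n, Measurable (X n)) (n : ℕ) (x : ℝ) :
    MeasurableSet (maxLE X n x) := by
  have : maxLE X n x = ⋂ k : ℕ, ⋂ _ : k ≤ n, X k ⁻¹' Set.Iic x := by
    ext ω
    simp [maxLE]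
  rw [this]
  exact MeasurableSet.iInter fun k => MeasurableSet.iInter fun _ => hX k measurableSet_Iic

lemma measurableSet_eventuallyAbove (hX : ∀ n, Measurable (X n)) :
    MeasurableSet (eventuallyAbove X ℓ) := by
  rw [← MeasurableSet.compl_iff, eventuallyAbove_compl]
  have e : {ω | ∃ᶠ n in atTop, ω ∈ maxLE X n (ℓ n)} =
      ⋂ N : ℕ, ⋃ n : ℕ, ⋃ _ : N ≤ n, maxLE X n (ℓ n) := by
    ext ω
    simp [frequently_atTop]
  rw [e]
  exact MeasurableSet.iInter fun N => MeasurableSet.iUnion fun n => MeasurableSet.iUnion fun _ =>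
    measurableSet_maxLE hX n _

lemma IsFAlphaScheme.measureReal_forall_le (hX : IsFAlphaScheme μ (cdf ν) α X) (c : ℕ → ℝ)
    (n : ℕ) : μ.real {ω | ∀ k < n, X k ω ≤ c k} =
      ∏ k ∈ Finset.range n, cdf ν (c k) ^ α k := by
  have e : {ω | ∀ k < n, X k ω ≤ c k} = ⋂ k ∈ Finset.range n, X k ⁻¹' Set.Iic (c k) := by
    ext ω
    simp
  rw [measureReal_def, e, hX.indep.measure_inter_preimage_eq_mul _
    (fun k _ => measurableSet_Iic), ENNReal.toReal_prod]
  refine Finset.prod_congr rfl fun k _ => ?_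
  have := hX.cdf_eq k (c k)
  rw [show X k ⁻¹' Set.Iic (c k) = {ω | X k ω ≤ c k} from rfl, this,
    ENNReal.toReal_ofReal (Real.rpow_nonneg (cdf_nonneg _ _) _)]

lemma IsFAlphaScheme.measureReal_maxLE (hX : IsFAlphaScheme μ (cdf ν) α X) (hα : ∀ n, 0 < α n)
    (n : ℕ) (x : ℝ) : μ.real (maxLE X n x) = cdf ν x ^ partialSum α n := by
  have e : maxLE X n x = {ω | ∀ k < n + 1, X k ω ≤ x} := by
    ext ω
    simp [maxLE]
  rw [e, hX.measureReal_forall_le (fun _ => x), partialSum,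
    Real.rpow_sum_of_nonneg (cdf_nonneg _ _) fun k _ => (hα k).le]

lemma partialSum_sub {i j : ℕ} (hij : i ≤ j) (α : ℕ → ℝ) :
    partialSum α j - partialSum α i = ∑ k ∈ Finset.Ico (i + 1) (j + 1), α k := by
  rw [partialSum, partialSum, Finset.sum_Ico_eq_sub _ (by omega)]

lemma IsFAlphaScheme.measureReal_maxLE_inter (hX : IsFAlphaScheme μ (cdf ν) α X)
    (hα : ∀ n, 0 < α n) (hℓ : Monotone ℓ) {i j : ℕ} (hij : i ≤ j) :
    μ.real (maxLE X i (ℓ i) ∩ maxLE X j (ℓ j)) =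
      cdf ν (ℓ i) ^ partialSum α i * cdf ν (ℓ j) ^ (partialSum α j - partialSum α i) := by
  have e : maxLE X i (ℓ i) ∩ maxLE X j (ℓ j) =
      {ω | ∀ k < j + 1, X k ω ≤ if k < i + 1 then ℓ i else ℓ j} := by
    ext ω
    constructor
    · rintro ⟨h1, h2⟩ k hk
      split_ifs with h
      · exact h1 k (by omega)
      · exact h2 k (by omega)
    · intro h
      refine ⟨fun k hk => ?_, fun k hk => ?_⟩
      · simpa [show k < i + 1 by omega] using h k (by omega)
      · refine (h k (by omega)).trans ?_
        split_ifs
        · exact hℓ hij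
        · exact le_rfl
  rw [e, hX.measureReal_forall_le (fun k => if k < i + 1 then ℓ i else ℓ j), partialSum_sub hij,
    partialSum, Real.rpow_sum_of_nonneg (cdf_nonneg _ _) fun k _ => (hα k).le,
    Real.rpow_sum_of_nonneg (cdf_nonneg _ _) fun k _ => (hα k).le,
    ← Finset.prod_range_mul_prod_Ico _ (show i + 1 ≤ j + 1 by omega)]
  congr 1
  · exact Finset.prod_congr rfl fun k hk => by rw [if_pos (Finset.mem_range.1 hk)]
  · exact Finset.prod_congr rfl fun k hk => by
      rw [if_neg (not_lt.2 (Finset.mem_Ico.1 hk).1)]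

end Scheme

/-! ### Recurrence criteria -/

section Criterion

variable {Ω : Type*} [MeasurableSpace Ω] {μ : Measure Ω} [IsProbabilityMeasure μ]
  {ν : Measure ℝ} {α : ℕ → ℝ} {X : ℕ → Ω → ℝ} {ℓ : ℕ → ℝ}

lemma tailAt_antitone (hℓ : Monotone ℓ) : Antitone (tailAt (cdf ν) ℓ) :=
  fun _ _ h => sub_le_sub_left (monotone_cdf ν (hℓ h)) 1

lemma tailAt_nonneg (n : ℕ) : 0 ≤ tailAt (cdf ν) ℓ n := sub_nonneg.2 (cdf_le_one ν _)

lemma cdf_eq_one_sub_tailAt (n : ℕ) : cdf ν (ℓ n) = 1 - tailAt (cdf ν) ℓ n := by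
  simp [tailAt]

lemma partialSum_succ_sub (α : ℕ → ℝ) (n : ℕ) :
    partialSum α (n + 1) - partialSum α n = α (n + 1) := by
  rw [partialSum, partialSum, Finset.sum_range_succ _ (n + 1)]
  ring

lemma partialSum_monotone (hα : ∀ n, 0 < α n) : Monotone (partialSum α) :=
  monotone_nat_of_le_succ fun n => by linarith [partialSum_succ_sub α n, hα (n + 1)]

lemma partialSum_pos (hα : ∀ n, 0 < α n) (n : ℕ) : 0 < partialSum α n :=
  Finset.sum_pos (fun k _ => hα k) Finset.nonempty_range_add_one

lemma IsFAlphaScheme.ae_exists_le (hX : IsFAlphaScheme μ (cdf ν) α X)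
    (hq : Tendsto (tailAt (cdf ν) ℓ) atTop (𝓝 0)) (j : ℕ) :
    ∀ᵐ ω ∂μ, ∃ n, X j ω ≤ ℓ n := by
  have hm : MeasurableSet {ω | ∃ n, X j ω ≤ ℓ n} := by
    rw [Set.ofPred_exists]
    exact MeasurableSet.iUnion fun n => hX.measurable j measurableSet_Iic
  change {ω | ∃ n, X j ω ≤ ℓ n} ∈ ae μ
  rw [mem_ae_iff_prob_eq_one hm]
  refine le_antisymm prob_le_one ?_
  have ht : Tendsto (fun n => ENNReal.ofReal (cdf ν (ℓ n) ^ α j)) atTop (𝓝 1) := by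
    have h1 : Tendsto (fun n => cdf ν (ℓ n)) atTop (𝓝 1) := by
      simpa [cdf_eq_one_sub_tailAt] using hq.const_sub 1
    have h2 := h1.rpow_const (p := α j) (Or.inl one_ne_zero)
    rw [Real.one_rpow] at h2
    simpa using ENNReal.tendsto_ofReal h2
  refine le_of_tendsto ht (Eventually.of_forall fun n => ?_)
  rw [← hX.cdf_eq j (ℓ n)]
  exact measure_mono fun ω hω => ⟨n, hω⟩

/-- A lower bound uniform in N survives in the limsup event, and the zero-one law excludes values
strictly between 0 and 1. The free set `s` allows a single event or a finite union. -/
lemma IsFAlphaScheme.measure_eventuallyAbove_eq_zero (hX : IsFAlphaScheme μ (cdf ν) α X)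
    (hℓ : Monotone ℓ) (hq : Tendsto (tailAt (cdf ν) ℓ) atTop (𝓝 0)) {δ : ℝ} (hδ : 0 < δ)
    (h : ∀ N, ∃ s : Set Ω, s ⊆ ⋃ n ≥ N, maxLE X n (ℓ n) ∧ δ ≤ μ.real s) :
    μ (eventuallyAbove X ℓ) = 0 := by
  have hm := measurableSet_eventuallyAbove (ℓ := ℓ) hX.measurable
  have h1 : ENNReal.ofReal δ ≤ μ (eventuallyAbove X ℓ)ᶜ := by
    rw [eventuallyAbove_compl]
    refine le_measure_frequently (fun n => measurableSet_maxLE hX.measurable n _) fun N => ?_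
    obtain ⟨s, hs, hδs⟩ := h N
    exact (ENNReal.ofReal_le_of_le_toReal hδs).trans (measure_mono hs)
  rcases measure_frequently_forall_le_eq_zero_or_one hX.measurable hX.indep hℓ
    (hX.ae_exists_le hq) with h0 | h0
  · have h2 : μ (eventuallyAbove X ℓ)ᶜ = 0 := by rw [eventuallyAbove_compl]; exact h0
    rw [h2, nonpos_iff_eq_zero, ENNReal.ofReal_eq_zero] at h1
    linarith
  · have h2 : μ (eventuallyAbove X ℓ)ᶜ = 1 := by rw [eventuallyAbove_compl]; exact h0
    exact (prob_compl_eq_one_iff hm).1 h2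

lemma IsFAlphaScheme.measure_eventuallyAbove_eq_one_of_tail_pos
    (hX : IsFAlphaScheme μ (cdf ν) α X) (hα : ∀ n, 0 < α n)
    (hs : Tendsto (partialSum α) atTop atTop) (hℓ : Monotone ℓ) {c : ℝ} (hc : 0 < c)
    (hq : Tendsto (tailAt (cdf ν) ℓ) atTop (𝓝 c)) : μ (eventuallyAbove X ℓ) = 1 := by
  rw [← prob_compl_eq_zero_iff (measurableSet_eventuallyAbove hX.measurable),
    eventuallyAbove_compl]
  have hcq : ∀ n, c ≤ tailAt (cdf ν) ℓ n := (tailAt_antitone hℓ).le_of_tendsto hq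
  have hc1 : 0 ≤ 1 - c := by
    have := hcq 0
    have := cdf_nonneg ν (ℓ 0)
    rw [cdf_eq_one_sub_tailAt] at this
    linarith
  -- Recurrence forces X_0, …, X_N below some common ℓ_n, and F(ℓ_n) ≤ 1 - c for every n.
  have hb : ∀ N, μ {ω | ∃ᶠ n in atTop, ω ∈ maxLE X n (ℓ n)} ≤
      ENNReal.ofReal ((1 - c) ^ partialSum α N) := by
    intro N
    have hmono : Monotone fun n => maxLE X N (ℓ n) :=
      fun a b hab ω hω k hk => (hω k hk).trans (hℓ hab)
    calc _ ≤ μ (⋃ n, maxLE X N (ℓ n)) := by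
          refine measure_mono fun ω hω => ?_
          obtain ⟨n, hn, h⟩ := (frequently_atTop.1 hω) N
          exact Set.mem_iUnion.2 ⟨n, fun k hk => h k (hk.trans hn)⟩
      _ = ⨆ n, μ (maxLE X N (ℓ n)) := hmono.measure_iUnion
      _ ≤ _ := by
          refine iSup_le fun n => ?_
          rw [← ofReal_measureReal, hX.measureReal_maxLE hα]
          refine ENNReal.ofReal_le_ofReal (Real.rpow_le_rpow (cdf_nonneg _ _) ?_
            (partialSum_pos hα N).le)
          rw [cdf_eq_one_sub_tailAt]
          linarith [hcq n]
  have ht : Tendsto (fun N => ENNReal.ofReal ((1 - c) ^ partialSum α N)) atTop (𝓝 0) := by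
    have := (tendsto_rpow_atTop_of_base_lt_one (1 - c) (by linarith) (by linarith)).comp hs
    simpa using ENNReal.tendsto_ofReal this
  exact le_antisymm (ge_of_tendsto' ht hb) zero_le

lemma eventually_tailAt_le_half (hq : Tendsto (tailAt (cdf ν) ℓ) atTop (𝓝 0)) :
    ∀ᶠ n in atTop, tailAt (cdf ν) ℓ n ≤ 1 / 2 :=
  hq.eventually_le_const (by norm_num)

lemma IsFAlphaScheme.measure_eventuallyAbove_eq_zero_of_frequently_le
    (hX : IsFAlphaScheme μ (cdf ν) α X) (hα : ∀ n, 0 < α n) (hℓ : Monotone ℓ)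
    (hq : Tendsto (tailAt (cdf ν) ℓ) atTop (𝓝 0)) {C : ℝ}
    (hC : ∃ᶠ n in atTop, partialSum α n * tailAt (cdf ν) ℓ n ≤ C) :
    μ (eventuallyAbove X ℓ) = 0 := by
  refine hX.measure_eventuallyAbove_eq_zero hℓ hq (Real.exp_pos (-(2 * C))) fun N => ?_
  obtain ⟨n, hn, h1, h2⟩ :=
    (frequently_atTop.1 (hC.and_eventually (eventually_tailAt_le_half hq))) N
  refine ⟨maxLE X n (ℓ n), Set.subset_biUnion_of_mem (u := fun n => maxLE X n (ℓ n)) hn, ?_⟩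
  rw [hX.measureReal_maxLE hα, cdf_eq_one_sub_tailAt]
  calc Real.exp (-(2 * C)) ≤ Real.exp (-(2 * tailAt (cdf ν) ℓ n)) ^ partialSum α n := by
        rw [← Real.exp_mul]
        exact Real.exp_le_exp.2 (by linarith)
    _ ≤ _ := Real.rpow_le_rpow (Real.exp_pos _).le
        (exp_neg_two_mul_le_one_sub (tailAt_nonneg n) h2) (partialSum_pos hα n).le

lemma seriesK_term_nonneg (hα : ∀ n, 0 < α n) (n : ℕ) :
    0 ≤ Real.exp (-(partialSum α n * tailAt (cdf ν) ℓ n)) *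
      (1 - Real.exp (-(α (n + 1) * tailAt (cdf ν) ℓ n))) := by
  refine mul_nonneg (Real.exp_pos _).le (sub_nonneg.2 (Real.exp_le_one_iff.2 ?_))
  exact neg_nonpos.2 (mul_nonneg (hα _).le (tailAt_nonneg n))

/-- Transition probabilities `P(X 0, …, X n ≤ ℓ n < X (n + 1))`. -/
lemma IsFAlphaScheme.measureReal_maxLE_inter_gt (hX : IsFAlphaScheme μ (cdf ν) α X)
    (hα : ∀ n, 0 < α n) (n : ℕ) :
    μ.real (maxLE X n (ℓ n) ∩ {ω | ℓ n < X (n + 1) ω}) =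
      (1 - tailAt (cdf ν) ℓ n) ^ partialSum α n *
        (1 - (1 - tailAt (cdf ν) ℓ n) ^ α (n + 1)) := by
  have e : maxLE X n (ℓ n) ∩ {ω | ℓ n < X (n + 1) ω} =
      maxLE X n (ℓ n) \ maxLE X (n + 1) (ℓ n) := by
    ext ω
    constructor
    · rintro ⟨h1, h2⟩
      exact ⟨h1, fun h => (h (n + 1) le_rfl).not_gt h2⟩
    · rintro ⟨h1, h2⟩
      refine ⟨h1, ?_⟩
      by_contra h
      refine h2 fun k hk => ?_
      rcases Nat.le_succ_iff.1 hk with hk | rfl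
      · exact h1 k hk
      · exact not_lt.1 h
  have hsub : maxLE X (n + 1) (ℓ n) ⊆ maxLE X n (ℓ n) := fun ω h k hk => h k (by omega)
  rw [e, measureReal_sdiff hsub (measurableSet_maxLE hX.measurable _ _), hX.measureReal_maxLE hα,
    hX.measureReal_maxLE hα, ← cdf_eq_one_sub_tailAt, ← partialSum_succ_sub α n, mul_sub, mul_one,
    ← Real.rpow_add_of_nonneg (cdf_nonneg _ _) (partialSum_pos hα n).le
      (by rw [partialSum_succ_sub]; exact (hα _).le)]
  congr 2
  ring

lemma IsFAlphaScheme.measure_eventuallyAbove_eq_one_of_seriesK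
    (hX : IsFAlphaScheme μ (cdf ν) α X) (hα : ∀ n, 0 < α n) (hℓ : Monotone ℓ)
    (hq : Tendsto (tailAt (cdf ν) ℓ) atTop (𝓝 0))
    (hsq : Tendsto (fun n => partialSum α n * tailAt (cdf ν) ℓ n) atTop atTop)
    (hK : seriesK (cdf ν) α ℓ < ⊤) : μ (eventuallyAbove X ℓ) = 1 := by
  obtain ⟨N, hN⟩ := eventually_atTop.1 (eventually_tailAt_le_half hq)
  set b : ℕ → ℝ := fun n => Real.exp (-(partialSum α n * tailAt (cdf ν) ℓ n)) *
      (1 - Real.exp (-(α (n + 1) * tailAt (cdf ν) ℓ n))) with hb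
  have hbs : Summable b := by
    have := ENNReal.summable_toReal hK.ne
    refine this.congr fun n => ENNReal.toReal_ofReal (seriesK_term_nonneg hα n)
  -- almost surely only finitely many upcrossings
  have hup : ∀ᵐ ω ∂μ, ∀ᶠ n in atTop, ω ∉ maxLE X n (ℓ n) ∩ {ω | ℓ n < X (n + 1) ω} := by
    have hsum : ∑' n, μ (maxLE X (n + N) (ℓ (n + N)) ∩ {ω | ℓ (n + N) < X (n + N + 1) ω}) ≠ ⊤ := by
      have hle : ∀ n, μ (maxLE X (n + N) (ℓ (n + N)) ∩ {ω | ℓ (n + N) < X (n + N + 1) ω}) ≤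
          ENNReal.ofReal (2 * b (n + N)) := by
        intro n
        rw [← ofReal_measureReal, hX.measureReal_maxLE_inter_gt hα]
        exact ENNReal.ofReal_le_ofReal (scheme_weight_le (partialSum_pos hα _).le (hα _).le
          (tailAt_nonneg _) (hN _ (Nat.le_add_left _ _)))
      refine ne_top_of_le_ne_top ?_ (ENNReal.tsum_le_tsum hle)
      exact (((summable_nat_add_iff N).2 hbs).mul_left 2).tsum_ofReal_ne_top
    filter_upwards [ae_eventually_notMem hsum] with ω hω
    obtain ⟨M, hM⟩ := eventually_atTop.1 hω
    filter_upwards [eventually_ge_atTop (M + N)] with n hn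
    have := hM (n - N) (by omega)
    rwa [Nat.sub_add_cancel (by omega : N ≤ n)] at this
  -- almost surely the level is exceeded infinitely often
  have hex : ∀ᵐ ω ∂μ, ∃ᶠ n in atTop, ω ∉ maxLE X n (ℓ n) := by
    have ht : Tendsto (fun n => μ (maxLE X n (ℓ n))) atTop (𝓝 0) := by
      have h1 : Tendsto (fun n => Real.exp (-(partialSum α n * tailAt (cdf ν) ℓ n))) atTop (𝓝 0) :=
        Real.tendsto_exp_neg_atTop_nhds_zero.comp hsq
      have h2 := ENNReal.tendsto_ofReal h1
      rw [ENNReal.ofReal_zero] at h2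
      refine tendsto_of_tendsto_of_tendsto_of_le_of_le' tendsto_const_nhds h2
        (Eventually.of_forall fun n => zero_le) ?_
      filter_upwards [eventually_tailAt_le_half hq] with n hn
      rw [← ofReal_measureReal, hX.measureReal_maxLE hα, cdf_eq_one_sub_tailAt]
      have hp : 0 < 1 - tailAt (cdf ν) ℓ n := by linarith
      refine ENNReal.ofReal_le_ofReal ?_
      rw [Real.rpow_def_of_pos hp]
      refine Real.exp_le_exp.2 ?_
      nlinarith [Real.log_le_sub_one_of_pos hp, partialSum_pos hα n]
    rw [ae_iff]
    have e : {ω | ¬∃ᶠ n in atTop, ω ∉ maxLE X n (ℓ n)} =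
        ⋃ N, ⋂ n ≥ N, maxLE X n (ℓ n) := by
      ext ω
      simp [frequently_atTop]
    rw [e, measure_iUnion_null_iff]
    intro M
    refine le_antisymm (ge_of_tendsto ht ?_) zero_le
    filter_upwards [eventually_ge_atTop M] with n hn
    exact measure_mono (Set.biInter_subset_of_mem hn)
  refine (mem_ae_iff_prob_eq_one (measurableSet_eventuallyAbove hX.measurable)).1 ?_
  filter_upwards [hup, hex] with ω h1 h2
  obtain ⟨M, hM⟩ := eventually_atTop.1 h1
  by_contra hω
  have hfreq : ω ∈ (eventuallyAbove X ℓ)ᶜ := hω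
  rw [eventuallyAbove_compl] at hfreq
  obtain ⟨p, hp, hpE⟩ := (frequently_atTop.1 hfreq) M
  -- Beyond M there are no upcrossings, so membership at p propagates to every later index, against
  -- `h2`.
  have key : ∀ n, p ≤ n → ω ∈ maxLE X n (ℓ n) := by
    intro n hn
    induction n, hn using Nat.le_induction with
    | base => exact hpE
    | succ n hn ih =>
      have hX' : X (n + 1) ω ≤ ℓ n := by
        by_contra h
        exact hM n (hp.trans hn) ⟨ih, not_le.1 h⟩
      intro k hk
      refine le_trans ?_ (hℓ n.le_succ)
      rcases Nat.le_succ_iff.1 hk with hk | rfl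
      · exact ih k hk
      · exact hX'
  obtain ⟨n, hn, h⟩ := (frequently_atTop.1 h2) p
  exact h (key n hn)

lemma summable_inv_sub_inv {s : ℕ → ℝ} (hs0 : ∀ n, 0 < s n) (hs : Monotone s) :
    Summable fun n => (s n)⁻¹ - (s (n + 1))⁻¹ := by
  refine summable_of_sum_range_le (c := (s 0)⁻¹)
    (fun n => sub_nonneg.2 (inv_anti₀ (hs0 n) (hs n.le_succ))) fun n => ?_
  rw [Finset.sum_range_sub']
  linarith [inv_pos.2 (hs0 n)]

lemma not_summable_scheme_weight (hα : ∀ n, 0 < α n)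
    (hs : Tendsto (partialSum α) atTop atTop)
    (hq : Tendsto (tailAt (cdf ν) ℓ) atTop (𝓝 0)) (hK : seriesK (cdf ν) α ℓ = ⊤) :
    ¬ Summable fun n => (1 - tailAt (cdf ν) ℓ n) ^ partialSum α n *
        (1 - (1 - tailAt (cdf ν) ℓ n) ^ α (n + 1)) := by
  intro ha
  have hb : Summable fun n => Real.exp (-(partialSum α n * tailAt (cdf ν) ℓ n)) *
      (1 - Real.exp (-(α (n + 1) * tailAt (cdf ν) ℓ n))) := by
    refine Summable.of_norm_bounded_eventually_nat ((ha.mul_left (Real.exp 16)).add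
      (summable_inv_sub_inv (partialSum_pos hα) (partialSum_monotone hα))) ?_
    filter_upwards [eventually_tailAt_le_half hq, hs.eventually_ge_atTop (Real.exp 1)] with n h1 h2
    rw [Real.norm_of_nonneg (seriesK_term_nonneg hα n), ← partialSum_succ_sub α n]
    exact exp_weight_le h2 (partialSum_monotone hα n.le_succ) (tailAt_nonneg n) h1
  exact hb.tsum_ofReal_ne_top hK

lemma IsFAlphaScheme.measure_eventuallyAbove_eq_zero_of_seriesK
    (hX : IsFAlphaScheme μ (cdf ν) α X) (hα : ∀ n, 0 < α n)
    (hs : Tendsto (partialSum α) atTop atTop) (hℓ : Monotone ℓ)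
    (hq : Tendsto (tailAt (cdf ν) ℓ) atTop (𝓝 0))
    (hK : seriesK (cdf ν) α ℓ = ⊤) : μ (eventuallyAbove X ℓ) = 0 := by
  obtain ⟨N₀, hN₀⟩ := eventually_atTop.1 (eventually_tailAt_le_half hq)
  refine hX.measure_eventuallyAbove_eq_zero hℓ hq (δ := 1 / (2 * 80)) (by norm_num) fun N' => ?_
  -- Starting beyond N₀ keeps F(ℓ_n) ≥ 1/2, so r is well behaved; starting beyond N' places the
  -- union in the required tail.
  set N := max N₀ N' with hNdef
  set σ : ℕ → ℝ := fun n => partialSum α (n + N) with hσ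
  set r : ℕ → ℝ := fun n => -Real.log (cdf ν (ℓ (n + N))) with hr
  set E : ℕ → Set Ω := fun n => maxLE X (n + N) (ℓ (n + N)) with hE
  set w : ℕ → ℝ := fun n => 1 - Real.exp (-((σ (n + 1) - σ n) * r n)) with hw
  set a : ℕ → ℝ := fun n => w n * Real.exp (-(σ n * r n)) with ha
  have hF : ∀ n, 0 < cdf ν (ℓ (n + N)) := fun n => by
    rw [cdf_eq_one_sub_tailAt]
    linarith [hN₀ (n + N) (by omega)]
  have hpow : ∀ n x, cdf ν (ℓ (n + N)) ^ x = Real.exp (-(x * r n)) := fun n x => by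
    rw [Real.rpow_def_of_pos (hF n)]
    congr 1
    simp only [hr]
    ring
  have hr0 : ∀ n, 0 ≤ r n := fun n =>
    neg_nonneg.2 (Real.log_nonpos (hF n).le (cdf_le_one ν _))
  have hra : Antitone r := fun m n hmn =>
    neg_le_neg (Real.log_le_log (hF m) (monotone_cdf ν (hℓ (by omega))))
  have hσ0 : ∀ n, 0 < σ n := fun n => partialSum_pos hα _
  have hσm : Monotone σ := fun m n hmn => partialSum_monotone hα (by omega)
  have hσs : ∀ n, σ (n + 1) - σ n = α (n + N + 1) := fun n => by
    rw [← partialSum_succ_sub α (n + N)]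
    simp only [hσ]
    rw [show n + 1 + N = n + N + 1 by omega]
  have ha0 : ∀ n, 0 ≤ a n := fun n =>
    mul_nonneg (one_sub_exp_nonneg hσm hr0 n) (Real.exp_pos _).le
  have hEr : ∀ n, μ.real (E n) = Real.exp (-(σ n * r n)) := fun n => by
    rw [← hpow, hX.measureReal_maxLE hα]
  have hns : ¬ Summable a := by
    intro h
    refine not_summable_scheme_weight hα hs hq hK ((summable_nat_add_iff N).1 ?_)
    refine h.congr fun n => ?_
    rw [← cdf_eq_one_sub_tailAt, hpow, hpow, ← hσs, mul_comm]
  obtain ⟨m, hm⟩ :=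
    (((not_summable_iff_tendsto_nat_atTop_of_nonneg ha0).1 hns).eventually_ge_atTop 1).exists
  refine ⟨⋃ n ∈ Finset.range m, E n, ?_, ?_⟩
  · refine Set.iUnion₂_subset fun n _ => ?_
    exact Set.subset_biUnion_of_mem (u := fun n => maxLE X n (ℓ n))
      (show n + N ∈ {n | n ≥ N'} by simp only [Set.mem_ofPred_eq]; omega)
  · refine le_measureReal_biUnion_of_second_moment (w := w)
      (fun n => measurableSet_maxLE hX.measurable _ _) (by norm_num) m
      (A := ∑ n ∈ Finset.range m, a n) ?_ hm ?_
    · exact Finset.sum_congr rfl fun n _ => by rw [hEr]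
    · refine sum_weighted_joint_le hσ0 hσm hr0 hra (fun n => rfl) (fun n => rfl)
        (J := fun i j => μ.real (E i ∩ E j)) (fun i j => by rw [Set.inter_comm])
        (fun i j hij => ?_) m
      rw [hX.measureReal_maxLE_inter hα hℓ (show i + N ≤ j + N by omega), hpow, hpow,
        ← Real.exp_add, neg_add]

end Criterion

/-! ### The four claims -/

theorem corollary2 {Ω : Type*} [MeasurableSpace Ω] (μ : Measure Ω) [IsProbabilityMeasure μ]
    (ν : Measure ℝ) [IsProbabilityMeasure ν] (hF : Continuous (cdf ν))
    (α : ℕ → ℝ) (hα : ∀ n, 0 < α n) (hs : Tendsto (partialSum α) atTop atTop)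
    (X : ℕ → Ω → ℝ) (hX : IsFAlphaScheme μ (cdf ν) α X)
    (ℓ : ℕ → ℝ) (hℓ : Monotone ℓ) :
    (μ (eventuallyAbove X ℓ) = 0 ∨ μ (eventuallyAbove X ℓ) = 1) ∧
    (∀ c : ℝ, 0 < c → Tendsto (tailAt (cdf ν) ℓ) atTop (𝓝 c) →
      μ (eventuallyAbove X ℓ) = 1) ∧
    (Tendsto (tailAt (cdf ν) ℓ) atTop (𝓝 0) →
      liminf (fun n => ((partialSum α n * tailAt (cdf ν) ℓ n : ℝ) : EReal)) atTop < ⊤ →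
      μ (eventuallyAbove X ℓ) = 0) ∧
    (Tendsto (tailAt (cdf ν) ℓ) atTop (𝓝 0) →
      Tendsto (fun n => partialSum α n * tailAt (cdf ν) ℓ n) atTop atTop →
      (seriesK (cdf ν) α ℓ = ⊤ → μ (eventuallyAbove X ℓ) = 0) ∧
      (seriesK (cdf ν) α ℓ < ⊤ → μ (eventuallyAbove X ℓ) = 1)) := by
  have pos : ∀ c : ℝ, 0 < c → Tendsto (tailAt (cdf ν) ℓ) atTop (𝓝 c) →
      μ (eventuallyAbove X ℓ) = 1 := fun c hc hq =>
    hX.measure_eventuallyAbove_eq_one_of_tail_pos hα hs hℓ hc hq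
  have freq : Tendsto (tailAt (cdf ν) ℓ) atTop (𝓝 0) → ∀ C : ℝ,
      (∃ᶠ n in atTop, partialSum α n * tailAt (cdf ν) ℓ n ≤ C) →
      μ (eventuallyAbove X ℓ) = 0 := fun hq C hC =>
    hX.measure_eventuallyAbove_eq_zero_of_frequently_le hα hℓ hq hC
  have series : Tendsto (tailAt (cdf ν) ℓ) atTop (𝓝 0) →
      Tendsto (fun n => partialSum α n * tailAt (cdf ν) ℓ n) atTop atTop →
      (seriesK (cdf ν) α ℓ = ⊤ → μ (eventuallyAbove X ℓ) = 0) ∧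
      (seriesK (cdf ν) α ℓ < ⊤ → μ (eventuallyAbove X ℓ) = 1) := fun hq hsq =>
    ⟨hX.measure_eventuallyAbove_eq_zero_of_seriesK hα hs hℓ hq,
      hX.measure_eventuallyAbove_eq_one_of_seriesK hα hℓ hq hsq⟩
  refine ⟨?_, pos, fun hq hlim => ?_, series⟩
  -- The other three claims are exhaustive: q_n is non-increasing and bounded below, hence
  -- converges, and if s_n q_n does not tend to infinity it is bounded along a subsequence.
  · have hlim := tendsto_atTop_ciInf (tailAt_antitone (ν := ν) hℓ)
      ⟨0, Set.forall_mem_range.2 fun n => tailAt_nonneg n⟩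
    have h0 : 0 ≤ ⨅ n, tailAt (cdf ν) ℓ n := le_ciInf fun n => tailAt_nonneg n
    rcases h0.eq_or_lt with h | h
    · rw [← h] at hlim
      by_cases hsq : Tendsto (fun n => partialSum α n * tailAt (cdf ν) ℓ n) atTop atTop
      · rcases eq_or_ne (seriesK (cdf ν) α ℓ) ⊤ with hK | hK
        · exact Or.inl ((series hlim hsq).1 hK)
        · exact Or.inr ((series hlim hsq).2 hK.lt_top)
      · rw [tendsto_atTop] at hsq
        push Not at hsq
        obtain ⟨C, hC⟩ := hsq
        exact Or.inl (freq hlim C (hC.mono fun n hn => hn.le))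
    · exact Or.inr (pos _ h hlim)
  · obtain ⟨C, hC, hCt⟩ := EReal.lt_iff_exists_real_btwn.1 hlim
    refine freq hq C ((frequently_lt_of_liminf_lt (by isBoundedDefault) hC).mono fun n hn => ?_)
    exact_mod_cast hn.le
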